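/- Let $a<b$, $k\ge 1$ an integer and $0<\alpha\le 1$. Let $C^{k,\alpha}([a,b])$ be the Hölder space of real functions on $[a,b]$ of class $C^k$ whose $k$-th derivative is $\alpha$-Hölder continuous, with norm $\sum_{j\le k}\sup|y^{(j)}|+[y^{(k)}]_\alpha$. Let $G:\mathbb R\times[a,b]\times[a,b]\to\mathbb R$, $(u,x,s)\mapsto G(u,x,s)$, be continuous and continuously differentiable with respect to $u$ and with respect to $s$, and let $T: C^{k,\alpha}([a,b])\to C^{k,\alpha}([a,b])$ be the Urysohn integral operator $$T(y)(x)=\int_a^b G(y(s),x,s)\,ds .$$ Let $\mathbb K\subset C^{k,\alpha}([a,b])$ be compact. Given a discretization $a=t_0<t_1<\dots<t_n=b$ and nodes $q_k\in[t_{k-1},t_k]$, $k=1,\dots,n$, put $$\mathcal T(y)(x)=\sum_{k=1}^n G(y(q_k),x,q_k)\,(t_k-t_{k-1}),\qquad \Omega=[t_0,t_1]\times\dots\times[t_{n-1},t_n].$$ A transformer $\mathcal W$ (for sequences of $n$ tokens in $\mathbb R^2$, with scalar outputs) is the composition of a linear token embedding into $\mathbb R^d$ with added positional encodings $\mathbf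 p_1,\dots,\mathbf p_n\in\mathbb R^d$, at least one layer of the form $$Y_i=\mathrm{LayerNorm}_1\big(Z_i+\mathrm{MultiHead}(Z)_i\big),\qquad Z'_i=\mathrm{LayerNorm}_2\big(Y_i+\mathrm{FFN}(Y_i)\big),$$ and an affine map $\mathbb R^d\to\mathbb R$ applied to each token. Here $\mathrm{MultiHead}(Z)=\mathrm{Concat}(h_1,\dots,h_H)W^O$ with $h_j=\mathrm{softmax}\big(ZW_j^Q(ZW_j^K)^{\top}/\sqrt{d_k}\big)ZW_j^V$ (softmax of each row), $\mathrm{FFN}(v)=\mathrm{ReLU}(vW_1+b_1)W_2+b_2$, and $\mathrm{LayerNorm}(v)=\gamma\odot(v-\operatorname{mean}v)/\sqrt{\operatorname{var}v+\sigma}+\beta$, where $\gamma,\beta$ are parameters and $\sigma\ge0$ is any fixed constant (a quotient by $0$ is read as $0$). For $y\in C^{k,\alpha}([a,b])$ let $\mathcal W_y(x_1,\dots,x_n)\in\mathbb R^n$ be the output of $\mathcal W$ on the tokens $(x_1,y(q_1)),\dots,(x_n,y(q_n))$. Then for every $\varepsilon>0$ there is a discretization $a=t_0<\dots<t_n=b$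 such that, for every choice of nodes $q_k\in[t_{k-1},t_k]$, one has $|T(y)(x)-\mathcal T(y)(x)|<\varepsilon$ for all $y\in\mathbb K$ and $x\in[a,b]$, and there is a transformer $\mathcal W$, not depending on $y$ or $p$, such that for every $y\in\mathbb K$ and every real $p\ge1$ $$\Big(\sum_{i=1}^n\int_\Omega\big|\mathcal T(y)(x_i)-\mathcal W_y^i(x_1,\dots,x_n)\big|^p\,dx\Big)^{1/p}<\varepsilon \quad\text{and}\quad \Big(\sum_{i=1}^n\int_\Omega\big|T(y)(x_i)-\mathcal W_y^i(x_1,\dots,x_n)\big|^p\,dx\Big)^{1/p}<\varepsilon ,$$ all the integrals being finite. -/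

import Mathlib

open Set MeasureTheory
open scoped NNReal Matrix

noncomputable section

/-! ### Hölder spaces on a compact interval -/

section Holder

variable {a b : ℝ} (hab : a < b)

/-- The `j`-th derivative (one-sided at the end points) of a function on `[a,b]`. -/
def derivIcc (j : ℕ) (f : Icc a b → ℝ) : Icc a b → ℝ :=
  fun x => iteratedDerivWithin j (IccExtend hab.le f) (Icc a b) x

/-- `f` is of class `C^k` on `[a,b]` and its `k`-th derivative is `α`-Hölder continuous. -/
def MemHolderSpace (k : ℕ) (α : ℝ≥0) (f : Icc a b → ℝ) : Prop :=
  ContDiffOn ℝ k (IccExtend hab.le f) (Icc a b) ∧ MemHolder α (derivIcc hab k f)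

theorem derivIcc_add {k j : ℕ} (hj : j ≤ k) {f g : Icc a b → ℝ}
    (hf : ContDiffOn ℝ k (IccExtend hab.le f) (Icc a b))
    (hg : ContDiffOn ℝ k (IccExtend hab.le g) (Icc a b)) :
    derivIcc hab j (f + g) = derivIcc hab j f + derivIcc hab j g := by
  funext x
  have hj' : (j : WithTop ℕ∞) ≤ (k : WithTop ℕ∞) := by exact_mod_cast hj
  exact iteratedDerivWithin_add x.2 (uniqueDiffOn_Icc hab)
    ((hf x x.2).of_le hj') ((hg x x.2).of_le hj')

theorem derivIcc_smul (j : ℕ) (c : ℝ) (f : Icc a b → ℝ) :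
    derivIcc hab j (c • f) = c • derivIcc hab j f := by
  funext x
  exact iteratedDerivWithin_const_smul_field c (IccExtend hab.le f)

/-- The functions of class `C^{k,α}` on `[a,b]` form a vector space. -/
def holderSubmodule (k : ℕ) (α : ℝ≥0) : Submodule ℝ (Icc a b → ℝ) where
  carrier := {f | MemHolderSpace hab k α f}
  add_mem' := by
    intro f g hf hg
    refine ⟨hf.1.add hg.1, ?_⟩
    rw [derivIcc_add hab le_rfl hf.1 hg.1]
    exact hf.2.add hg.2
  zero_mem' := by
    refine ⟨contDiffOn_const, ?_⟩
    have h : derivIcc hab k (0 : Icc a b → ℝ) = 0 := by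
      simpa using derivIcc_smul hab k 0 (0 : Icc a b → ℝ)
    rw [h]
    exact memHolder_zero
  smul_mem' := by
    intro c f hf
    refine ⟨hf.1.const_smul c, ?_⟩
    rw [derivIcc_smul]
    exact hf.2.smul

/-- The Hölder space `C^{k,α}([a,b])`. It is a plain type synonym, so that its topology is the one
of the Hölder norm below and not the topology of pointwise convergence. -/
def HolderSpace (k : ℕ) (α : ℝ≥0) : Type := ↥(holderSubmodule hab k α)

variable {hab} {k : ℕ} {α : ℝ≥0}

instance : AddCommGroup (HolderSpace hab k α) :=
  inferInstanceAs (AddCommGroup ↥(holderSubmodule hab k α))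

instance : Module ℝ (HolderSpace hab k α) :=
  inferInstanceAs (Module ℝ ↥(holderSubmodule hab k α))

/-- The underlying function on `[a,b]`. -/
def HolderSpace.toFun (y : HolderSpace hab k α) : Icc a b → ℝ := y.1

/-- `y s` is the value of `y` at `s ∈ [a,b]` (off `[a,b]`, where it is never used, `y` is extended
by its boundary values). -/
instance : CoeFun (HolderSpace hab k α) (fun _ => ℝ → ℝ) := ⟨fun y => IccExtend hab.le y.toFun⟩

/-- The Hölder norm `∑_{j ≤ k} sup |y^{(j)}| + [y^{(k)}]_α`. -/
def HolderSpace.holderNorm (y : HolderSpace hab k α) : ℝ :=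
  (∑ j ∈ Finset.range (k + 1), ⨆ x : Icc a b, |derivIcc hab j y.toFun x|) +
    (nnHolderNorm α (derivIcc hab k y.toFun) : ℝ)

theorem HolderSpace.bddAbove_deriv (y : HolderSpace hab k α) {j : ℕ} (hj : j ≤ k) :
    BddAbove (range fun x : Icc a b => |derivIcc hab j y.toFun x|) := by
  have hj' : (j : WithTop ℕ∞) ≤ (k : WithTop ℕ∞) := by exact_mod_cast hj
  have hc : Continuous (derivIcc hab j y.toFun) :=
    continuousOn_iff_continuous_domRestrict.1
      (y.2.1.continuousOn_iteratedDerivWithin hj' (uniqueDiffOn_Icc hab))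
  exact (isCompact_range hc.abs).bddAbove

theorem HolderSpace.holderNorm_smul (c : ℝ) (y : HolderSpace hab k α) :
    (c • y).holderNorm = |c| * y.holderNorm := by
  have h : ∀ j, derivIcc hab j (c • y).toFun = c • derivIcc hab j y.toFun :=
    fun j => derivIcc_smul hab j c y.toFun
  have hn : nnHolderNorm α (c • derivIcc hab k y.toFun) =
      ‖c‖₊ * nnHolderNorm α (derivIcc hab k y.toFun) := MemHolder.nnHolderNorm_smul y.2.2 c
  simp only [holderNorm, h, hn, Pi.smul_apply, smul_eq_mul, abs_mul, NNReal.coe_mul, coe_nnnorm,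
    Real.norm_eq_abs, mul_add, Finset.mul_sum, Real.mul_iSup_of_nonneg (abs_nonneg c)]

theorem HolderSpace.holderNorm_add_le (y z : HolderSpace hab k α) :
    (y + z).holderNorm ≤ y.holderNorm + z.holderNorm := by
  have : Nonempty (Icc a b) := ⟨⟨a, le_rfl, hab.le⟩⟩
  have h : ∀ j ≤ k, derivIcc hab j (y + z).toFun = derivIcc hab j y.toFun + derivIcc hab j z.toFun :=
    fun j hj => derivIcc_add hab hj y.2.1 z.2.1
  have hn : (nnHolderNorm α (derivIcc hab k (y + z).toFun) : ℝ) ≤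
      nnHolderNorm α (derivIcc hab k y.toFun) + nnHolderNorm α (derivIcc hab k z.toFun) := by
    rw [h k le_rfl]
    exact_mod_cast MemHolder.nnHolderNorm_add_le y.2.2 z.2.2
  have hs : (∑ j ∈ Finset.range (k + 1), ⨆ x : Icc a b, |derivIcc hab j (y + z).toFun x|) ≤
      (∑ j ∈ Finset.range (k + 1), ⨆ x : Icc a b, |derivIcc hab j y.toFun x|) +
      ∑ j ∈ Finset.range (k + 1), ⨆ x : Icc a b, |derivIcc hab j z.toFun x| := by
    rw [← Finset.sum_add_distrib]
    refine Finset.sum_le_sum fun j hj => ?_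
    have hj' : j ≤ k := Nat.lt_succ_iff.1 (Finset.mem_range.1 hj)
    refine ciSup_le fun x => ?_
    rw [h j hj', Pi.add_apply]
    exact (abs_add_le _ _).trans
      (add_le_add (le_ciSup (y.bddAbove_deriv hj') x) (le_ciSup (z.bddAbove_deriv hj') x))
  unfold holderNorm
  linarith

theorem HolderSpace.eq_zero_of_holderNorm (y : HolderSpace hab k α) (hy : y.holderNorm = 0) :
    y = 0 := by
  have hnn : ∀ j ∈ Finset.range (k + 1), 0 ≤ ⨆ x : Icc a b, |derivIcc hab j y.toFun x| :=
    fun j _ => Real.iSup_nonneg fun x => abs_nonneg _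
  have h0 : (⨆ x : Icc a b, |derivIcc hab 0 y.toFun x|) ≤ 0 := by
    refine (Finset.single_le_sum hnn (Finset.mem_range.2 k.succ_pos)).trans ?_
    have := (nnHolderNorm α (derivIcc hab k y.toFun)).coe_nonneg
    unfold holderNorm at hy
    linarith
  refine Subtype.ext (funext fun x => ?_)
  have hx : |derivIcc hab 0 y.toFun x| ≤ 0 :=
    (le_ciSup (y.bddAbove_deriv (Nat.zero_le k)) x).trans h0
  have hx' := abs_nonpos_iff.1 hx
  have h1 : derivIcc hab 0 y.toFun x = y.1 x := by simp [derivIcc, HolderSpace.toFun]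
  exact h1.symm.trans hx'

instance : NormedAddCommGroup (HolderSpace hab k α) :=
  AddGroupNorm.toNormedAddCommGroup
    { toFun := HolderSpace.holderNorm
      map_zero' := by simpa using HolderSpace.holderNorm_smul 0 (0 : HolderSpace hab k α)
      add_le' := HolderSpace.holderNorm_add_le
      neg' := fun y => by simpa using HolderSpace.holderNorm_smul (-1) y
      eq_zero_of_map_eq_zero' := HolderSpace.eq_zero_of_holderNorm }

instance : NormedSpace ℝ (HolderSpace hab k α) where
  norm_smul_le c y := (HolderSpace.holderNorm_smul c y).le

end Holder

/-! ### Transformers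

A sequence of `n` tokens in `ℝ^d` is a matrix with `n` rows, one row for each token. -/

/-- The softmax of each row. -/
def softmaxRows {n : ℕ} (A : Matrix (Fin n) (Fin n) ℝ) : Matrix (Fin n) (Fin n) ℝ :=
  Matrix.of fun i j => Real.exp (A i j) / ∑ l, Real.exp (A i l)

/-- Scaled dot-product attention `softmax (Q Kᵀ / √d_k) V`. -/
def attention {n dk dv : ℕ} (Q K : Matrix (Fin n) (Fin dk) ℝ) (V : Matrix (Fin n) (Fin dv) ℝ) :
    Matrix (Fin n) (Fin dv) ℝ :=
  softmaxRows ((Real.sqrt dk)⁻¹ • (Q * Kᵀ)) * V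

/-- Layer normalisation of a vector, with gain `γ`, bias `β` and stabilising constant `s ≥ 0`:
`γ (v - mean v) / √(var v + s) + β`. -/
def layerNorm {d : ℕ} (s : ℝ) (γ β v : Fin d → ℝ) : Fin d → ℝ := fun j =>
  γ j * ((v j - (∑ l, v l) / d) /
    Real.sqrt ((∑ m, (v m - (∑ l, v l) / d) ^ 2) / d + s)) + β j

/-- The parameters of one transformer layer: token dimension `d`, number of heads `H`, query/key
dimension `dk`, value dimension `dv`, hidden width `r` of the feedforward network. -/
structure TransformerLayer (d H dk dv r : ℕ) where
  WQ : Fin H → Matrix (Fin d) (Fin dk) ℝ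
  WK : Fin H → Matrix (Fin d) (Fin dk) ℝ
  WV : Fin H → Matrix (Fin d) (Fin dv) ℝ
  WO : Matrix (Fin H × Fin dv) (Fin d) ℝ
  W₁ : Matrix (Fin d) (Fin r) ℝ
  b₁ : Fin r → ℝ
  W₂ : Matrix (Fin r) (Fin d) ℝ
  b₂ : Fin d → ℝ
  γ₁ : Fin d → ℝ
  β₁ : Fin d → ℝ
  γ₂ : Fin d → ℝ
  β₂ : Fin d → ℝ

namespace TransformerLayer

variable {n d H dk dv r : ℕ} (L : TransformerLayer d H dk dv r)

/-- Multi-head self-attention `Concat (h_1, …, h_H) W^O`. -/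
def multiHead (Z : Matrix (Fin n) (Fin d) ℝ) : Matrix (Fin n) (Fin d) ℝ :=
  (Matrix.of fun i (c : Fin H × Fin dv) =>
    attention (Z * L.WQ c.1) (Z * L.WK c.1) (Z * L.WV c.1) i c.2) * L.WO

/-- The position-wise feedforward network `ReLU (v W₁ + b₁) W₂ + b₂`. -/
def ffn (v : Fin d → ℝ) : Fin d → ℝ :=
  (fun l => max 0 ((v ᵥ* L.W₁ + L.b₁) l)) ᵥ* L.W₂ + L.b₂

/-- One layer: self-attention and feedforward network, each followed by a residual connection and
a layer normalisation. -/
def apply (s : ℝ) (Z : Matrix (Fin n) (Fin d) ℝ) : Matrix (Fin n) (Fin d) ℝ :=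
  let Y : Matrix (Fin n) (Fin d) ℝ :=
    Matrix.of fun i => layerNorm s L.γ₁ L.β₁ (Z i + L.multiHead Z i)
  Matrix.of fun i => layerNorm s L.γ₂ L.β₂ (Y i + L.ffn (Y i))

end TransformerLayer

/-- A transformer on sequences of `n` tokens in `ℝ^m` with scalar output tokens: a linear token
embedding, positional encodings, a nonempty stack of layers of the same dimensions, and an affine
readout applied to each token. -/
structure Transformer (n m : ℕ) where
  d : ℕ
  H : ℕ
  dk : ℕ
  dv : ℕ
  r : ℕ
  H_pos : 0 < H
  dk_pos : 0 < dk
  dv_pos : 0 < dv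
  embed : Matrix (Fin m) (Fin d) ℝ
  pos : Matrix (Fin n) (Fin d) ℝ
  layers : List (TransformerLayer d H dk dv r)
  layers_ne : layers ≠ []
  readout : Fin d → ℝ
  readoutBias : ℝ

/-- The sequence-to-sequence map `(ℝ^m)^n → ℝ^n` of a transformer. -/
def Transformer.eval {n m : ℕ} (W : Transformer n m) (s : ℝ) (X : Matrix (Fin n) (Fin m) ℝ) :
    Fin n → ℝ :=
  fun i => (W.layers.foldl (fun Z L => L.apply s Z) (X * W.embed + W.pos)) i ⬝ᵥ W.readout +
    W.readoutBias

/-! ### Discretizations and the component-wise `p`-norm -/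

/-- `a = t 0 < t 1 < ⋯ < t n = b`. -/
def IsDiscretization {n : ℕ} (a b : ℝ) (t : Fin (n + 1) → ℝ) : Prop :=
  StrictMono t ∧ t 0 = a ∧ t (Fin.last n) = b

/-- The product `[t 0, t 1] × ⋯ × [t (n-1), t n]` of the subintervals. -/
def cells {n : ℕ} (t : Fin (n + 1) → ℝ) : Set (Fin n → ℝ) :=
  Set.univ.pi fun i => Icc (t i.castSucc) (t i.succ)

/-- `∑_k G(y(q_k), x, q_k) w_k`, the rectangle rule for `∫ G(y(s), x, s) ds` on the
discretization `t` with nodes `q_k` and weights `w_k`, the lengths of the subintervals. -/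
def quadrature {n : ℕ} (G : ℝ → ℝ → ℝ → ℝ) (t : Fin (n + 1) → ℝ) (q : Fin n → ℝ) (y : ℝ → ℝ)
    (x : ℝ) : ℝ :=
  ∑ k, G (y (q k)) x (q k) * (t k.succ - t k.castSucc)

/-- The component-wise `p`-norm of `F` on the product of the subintervals (Lebesgue measure) is
finite and less than `ε`. -/
def CompNormLT {n : ℕ} (t : Fin (n + 1) → ℝ) (p ε : ℝ) (F : (Fin n → ℝ) → Fin n → ℝ) : Prop :=
  (∀ i, IntegrableOn (fun x => |F x i| ^ p) (cells t)) ∧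
    (∑ i, ∫ x in cells t, |F x i| ^ p) ^ (1 / p) < ε

end

noncomputable section

/-! ### Universal approximation by one hidden layer of ReLU units -/

/-! A quadrature estimate reduces the problem to approximating one continuous function, and a single
transformer layer suffices for that. Since `K` is compact and evaluation is jointly continuous, `(y,
x, s) ↦ G (y s) x s` is uniformly continuous on `K ×ˢ Icc a b ×ˢ Icc a b`. A fine uniform partition
therefore makes the rectangle rule accurate for all `y ∈ K`, all `x` and all nodes at once
(`abs_integral_sub_sum_le`). For fixed nodes the quadrature is a continuous function of `x i` and of
the vector of values `y (q j)`, which stays in a compact cube. In `gatherTransformer`, head `k` puts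
extra weight on token `k`, so every token receives `n` mixtures of the values, from which all the
values can be solved for; the residual connection keeps `x i` (`gatherTransformer_eval`). Layer
normalisation is harmless on both sides of the feedforward network. The first is invertible on
tokens containing a known `0` and a known `1` (`layerNorm_decode`). Before the second, the network
steers the token to a point of `balancedCurve`, where mean and variance do not depend on the encoded
number, so normalisation only divides it by a fixed constant (`exists_ffn_layerNorm_approx`). The
network exists by density of ReLU ridge functions (`exists_ffn_approx`). The uniform error passes to
all `p`-norms at once because `n` times the volume of the cells is at most `1` (`compNormLT_of_le`).
-/

/-- The span of the functions `t ↦ max 0 (w t + b)`. -/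
def reluSpan : Submodule ℝ (ℝ → ℝ) :=
  Submodule.span ℝ (range fun p : ℝ × ℝ => fun t => max 0 (p.1 * t + p.2))

theorem relu_mem_reluSpan (w b : ℝ) : (fun t => max 0 (w * t + b)) ∈ reluSpan :=
  Submodule.subset_span ⟨(w, b), rfl⟩

theorem const_mem_reluSpan (c : ℝ) : (fun _ => c) ∈ reluSpan := by
  convert reluSpan.smul_mem c (relu_mem_reluSpan 0 1) using 1
  funext t
  simp

/-- Piecewise linear interpolation. -/
theorem exists_reluSpan_approx {g : ℝ → ℝ} (hg : Continuous g) {u v : ℝ} (huv : u < v)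
    {ε : ℝ} (hε : 0 < ε) : ∃ φ ∈ reluSpan, ∀ t ∈ Icc u v, |φ t - g t| ≤ ε := by
  obtain ⟨δ, hδ, hgδ⟩ := Metric.uniformContinuousOn_iff.1
    (isCompact_Icc.uniformContinuousOn_of_continuous (hg.continuousOn (s := Icc u v))) ε hε
  obtain ⟨N, hN⟩ := exists_nat_gt ((v - u) / δ)
  have hN0 : (0 : ℝ) < N := (div_pos (sub_pos.2 huv) hδ).trans hN
  set h : ℝ := (v - u) / N with hh
  have hh0 : 0 < h := div_pos (sub_pos.2 huv) hN0
  have hhδ : h < δ := by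
    rw [hh, div_lt_iff₀ hN0]
    rwa [div_lt_iff₀ hδ, mul_comm] at hN
  have hNh : u + N * h = v := by rw [hh]; field_simp; ring
  -- Interpolation is built from left to right. Keeping `φ` constant beyond the last node lets the
  -- next segment be added as a difference of two hinges without disturbing the earlier ones.
  have key : ∀ m : ℕ, m ≤ N → ∃ φ ∈ reluSpan, (∀ t ∈ Icc u (u + m * h), |φ t - g t| ≤ ε) ∧
      ∀ t, u + m * h ≤ t → φ t = g (u + m * h) := by
    intro m
    induction m with
    | zero =>
      intro _
      refine ⟨_, const_mem_reluSpan (g u), fun t ht => ?_, fun t _ => by simp⟩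
      have : t = u := le_antisymm (by simpa using ht.2) ht.1
      simp [this, hε.le]
    | succ m ih =>
      intro hm
      obtain ⟨φ, hφ, h1, h2⟩ := ih (by omega)
      set p := u + m * h with hp
      have hp' : u + (m + 1 : ℕ) * h = p + h := by rw [hp]; push_cast; ring
      have hpu : u ≤ p := by rw [hp]; nlinarith [(Nat.cast_nonneg m : (0 : ℝ) ≤ m)]
      have hpv : p + h ≤ v := by
        rw [← hp', ← hNh]
        have : ((m + 1 : ℕ) : ℝ) ≤ N := by exact_mod_cast hm
        nlinarith
      rw [hp']
      refine ⟨φ + ((g (p + h) - g p) / h) •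
        ((fun t => max 0 (1 * t + -p)) - fun t => max 0 (1 * t + -(p + h))),
        reluSpan.add_mem hφ (reluSpan.smul_mem _
          (reluSpan.sub_mem (relu_mem_reluSpan _ _) (relu_mem_reluSpan _ _))), ?_, ?_⟩
      · intro t ht
        simp only [Pi.add_apply, Pi.smul_apply, Pi.sub_apply, smul_eq_mul]
        rcases le_total t p with htp | htp
        · rw [max_eq_left (by linarith), max_eq_left (by linarith)]
          simpa using h1 t ⟨ht.1, htp⟩
        · have ht2 := ht.2
          rw [max_eq_right (by linarith), max_eq_left (by linarith), h2 t htp]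
          have e1 : |g p - g t| ≤ ε := (hgδ p ⟨hpu, by linarith⟩ t ⟨ht.1, by linarith⟩
            (by rw [Real.dist_eq, abs_lt]; constructor <;> linarith)).le
          have e2 : |g (p + h) - g t| ≤ ε := (hgδ (p + h) ⟨by linarith, hpv⟩ t
            ⟨ht.1, by linarith⟩ (by rw [Real.dist_eq, abs_lt]; constructor <;> linarith)).le
          set θ := (t - p) / h with hθ
          have hθ0 : 0 ≤ θ := div_nonneg (by linarith) hh0.le
          have hθ1 : θ ≤ 1 := (div_le_one hh0).2 (by linarith)
          have : g p + (g (p + h) - g p) / h * (1 * t + -p - 0) - g t =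
              (1 - θ) * (g p - g t) + θ * (g (p + h) - g t) := by
            rw [hθ]; field_simp; ring
          rw [this]
          refine (abs_add_le _ _).trans ?_
          rw [abs_mul, abs_mul, abs_of_nonneg hθ0, abs_of_nonneg (sub_nonneg.2 hθ1)]
          nlinarith
      · intro t ht
        simp only [Pi.add_apply, Pi.smul_apply, Pi.sub_apply, smul_eq_mul]
        rw [max_eq_right (by linarith), max_eq_right (by linarith), h2 t (by linarith)]
        field_simp
        ring
  obtain ⟨φ, hφ, h1, -⟩ := key N le_rfl
  exact ⟨φ, hφ, by rwa [hNh] at h1⟩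

/-! ### Density of ReLU ridge functions on a compact set -/

section Ridge

variable {d : ℕ} (C : Set (Fin d → ℝ))

/-- The ReLU ridge function `v ↦ max 0 (v ⬝ w + b)` on `C`. -/
def reluRidge (p : (Fin d → ℝ) × ℝ) : C(C, ℝ) where
  toFun v := max 0 (v.1 ⬝ᵥ p.1 + p.2)
  continuous_toFun := by
    have h : Continuous fun v : C => v.1 ⬝ᵥ p.1 := continuous_subtype_val.dotProduct continuous_const
    fun_prop

/-- The exponential ridge function `v ↦ exp (v ⬝ w)` on `C`. -/
def expRidge (w : Fin d → ℝ) : C(C, ℝ) where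
  toFun v := Real.exp (v.1 ⬝ᵥ w)
  continuous_toFun := by
    have h : Continuous fun v : C => v.1 ⬝ᵥ w := continuous_subtype_val.dotProduct continuous_const
    fun_prop

/-- The exponential ridge functions form a multiplicative monoid. -/
def expRidgeSubmonoid : Submonoid C(C, ℝ) where
  carrier := range (expRidge C)
  mul_mem' := by
    rintro _ _ ⟨w, rfl⟩ ⟨w', rfl⟩
    refine ⟨w + w', ?_⟩
    ext v
    simp [expRidge, dotProduct_add, Real.exp_add]
  one_mem' := by
    refine ⟨0, ?_⟩
    ext v
    simp [expRidge]

variable {C}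

theorem exists_comp_mem_span_reluRidge (w : Fin d → ℝ) {φ : ℝ → ℝ} (hφ : φ ∈ reluSpan) :
    ∃ ψ ∈ Submodule.span ℝ (range (reluRidge C)), ∀ v, ψ v = φ (v.1 ⬝ᵥ w) := by
  induction hφ using Submodule.span_induction with
  | mem φ h =>
    obtain ⟨p, rfl⟩ := h
    refine ⟨_, Submodule.subset_span ⟨(p.1 • w, p.2), rfl⟩, fun v => ?_⟩
    simp [reluRidge]
  | zero => exact ⟨0, Submodule.zero_mem _, fun v => rfl⟩
  | add φ φ' _ _ h h' =>
    obtain ⟨ψ, hψ, e⟩ := h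
    obtain ⟨ψ', hψ', e'⟩ := h'
    exact ⟨ψ + ψ', Submodule.add_mem _ hψ hψ', fun v => by simp [e, e']⟩
  | smul c φ _ h =>
    obtain ⟨ψ, hψ, e⟩ := h
    exact ⟨c • ψ, Submodule.smul_mem _ c hψ, fun v => by simp [e]⟩

/-- On a compact set `v ⬝ᵥ w` ranges over a bounded interval, so it is enough to interpolate
`Real.exp` there by hinges in one variable. -/
theorem expRidge_mem_closure [CompactSpace C] (w : Fin d → ℝ) :
    expRidge C w ∈ (Submodule.span ℝ (range (reluRidge C))).topologicalClosure := by
  refine Metric.mem_closure_iff.2 fun ε hε => ?_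
  have hc : Continuous fun v : C => v.1 ⬝ᵥ w :=
    continuous_subtype_val.dotProduct continuous_const
  obtain ⟨R, hR⟩ := (isCompact_range hc).isBounded.subset_closedBall 0
  have hR' : ∀ v : C, |v.1 ⬝ᵥ w| ≤ R := fun v => by simpa using hR ⟨v, rfl⟩
  obtain ⟨φ, hφ, h⟩ := exists_reluSpan_approx Real.continuous_exp
    (show -(|R| + 1) < |R| + 1 by linarith [abs_nonneg R]) (half_pos hε)
  obtain ⟨ψ, hψ, e⟩ := exists_comp_mem_span_reluRidge (C := C) w hφ
  refine ⟨ψ, hψ, lt_of_le_of_lt ?_ (half_lt_self hε)⟩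
  refine (ContinuousMap.dist_le (half_pos hε).le).2 fun v => ?_
  rw [dist_comm, Real.dist_eq, e]
  have := abs_le.1 ((hR' v).trans (le_abs_self R))
  exact h _ ⟨by linarith, by linarith⟩

/-- ReLU ridges are not closed under products, but exponential ridges are. The span of the latter is
thus an algebra that separates points, Stone–Weierstrass applies to it, and it lies in the closure
of the ReLU span. -/
theorem span_reluRidge_topologicalClosure [CompactSpace C] :
    (Submodule.span ℝ (range (reluRidge C))).topologicalClosure = ⊤ := by
  set A : Subalgebra ℝ C(C, ℝ) := Algebra.adjoin ℝ (expRidgeSubmonoid C : Set C(C, ℝ)) with hA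
  have hsep : A.SeparatesPoints := by
    intro v v' hne
    have : ∃ j, v.1 j ≠ v'.1 j := by
      by_contra! h
      exact hne (Subtype.ext (funext h))
    obtain ⟨j, hj⟩ := this
    refine ⟨expRidge C (Pi.single j 1), ⟨_, Algebra.subset_adjoin ⟨_, rfl⟩, rfl⟩, ?_⟩
    simpa [expRidge] using hj
  have hd := ContinuousMap.subalgebra_topologicalClosure_eq_top_of_separatesPoints A hsep
  have hle : (A : Set C(C, ℝ)) ⊆ (Submodule.span ℝ (range (reluRidge C))).topologicalClosure := by
    intro f hf
    have hf' : f ∈ Submodule.span ℝ (expRidgeSubmonoid C : Set C(C, ℝ)) := by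
      have : f ∈ Subalgebra.toSubmodule A := hf
      rwa [hA, Algebra.adjoin_eq_span, Submonoid.closure_eq] at this
    refine Submodule.span_le.2 ?_ hf'
    rintro _ ⟨w, rfl⟩
    exact expRidge_mem_closure w
  refine eq_top_iff.2 fun f _ => ?_
  have hf : f ∈ A.topologicalClosure := by rw [hd]; trivial
  exact closure_minimal hle (Submodule.isClosed_topologicalClosure _) hf

end Ridge

/-- Every vector field that is continuous on a compact set is a uniform limit of feedforward
networks with one hidden layer of ReLU units. -/
theorem exists_ffn_approx {d m : ℕ} {C : Set (Fin d → ℝ)} (hC : IsCompact C)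
    {F : (Fin d → ℝ) → Fin m → ℝ} (hF : ContinuousOn F C) {ε : ℝ} (hε : 0 < ε) :
    ∃ (r : ℕ) (W₁ : Matrix (Fin d) (Fin r) ℝ) (b₁ : Fin r → ℝ) (W₂ : Matrix (Fin r) (Fin m) ℝ),
      ∀ v ∈ C, ∀ j, |((fun l => max 0 ((v ᵥ* W₁ + b₁) l)) ᵥ* W₂) j - F v j| < ε := by
  classical
  have : CompactSpace C := isCompact_iff_compactSpace.1 hC
  have hj : ∀ j, ∃ c : ((Fin d → ℝ) × ℝ) →₀ ℝ, ∀ v : C,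
      |(c.sum fun p a => a * max 0 (v.1 ⬝ᵥ p.1 + p.2)) - F v j| < ε := by
    intro j
    let f : C(C, ℝ) := ⟨fun v => F v j,
      (continuous_apply j).comp (continuousOn_iff_continuous_domRestrict.1 hF)⟩
    have hf : f ∈ (Submodule.span ℝ (range (reluRidge C))).topologicalClosure := by
      rw [span_reluRidge_topologicalClosure]; trivial
    obtain ⟨ψ, hψ, hd⟩ := Metric.mem_closure_iff.1 hf ε hε
    obtain ⟨c, rfl⟩ := Finsupp.mem_span_range_iff_exists_finsupp.1 hψ
    refine ⟨c, fun v => ?_⟩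
    have := (ContinuousMap.dist_apply_le_dist v).trans_lt hd
    rw [dist_comm, Real.dist_eq] at this
    have e : (c.sum fun p a => a * max 0 (v.1 ⬝ᵥ p.1 + p.2)) =
        (c.sum fun p a => a • reluRidge C p) v := by
      rw [Finsupp.sum, Finsupp.sum, ContinuousMap.sum_apply]
      rfl
    rw [e]
    exact this
  choose c hc using hj
  -- All output coordinates share one hidden layer: its units are the union of the units used for
  -- each coordinate, with weight zero where a unit is not needed.
  let s : Finset ((Fin d → ℝ) × ℝ) := Finset.univ.biUnion fun j => (c j).support
  let e := s.equivFin
  refine ⟨s.card, Matrix.of fun i l => (e.symm l).1.1 i, fun l => (e.symm l).1.2,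
    Matrix.of fun l j => c j (e.symm l).1, fun v hv j => ?_⟩
  convert hc j ⟨v, hv⟩ using 3
  rw [Finsupp.sum_of_support_subset (c j) (s := s)
    (Finset.subset_biUnion_of_mem (fun j => (c j).support) (Finset.mem_univ j)) _ (by simp),
    ← Finset.sum_coe_sort, ← e.symm.sum_comp]
  simp only [Matrix.vecMul, dotProduct, Matrix.of_apply, Pi.add_apply]
  exact Finset.sum_congr rfl fun l _ => mul_comm _ _

/-! ### Layer normalisation -/

section LayerNorm

variable {d : ℕ} {s : ℝ}

theorem layerNorm_sub (v : Fin d → ℝ) (i j : Fin d) :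
    layerNorm s 1 0 v i - layerNorm s 1 0 v j =
      (v i - v j) / Real.sqrt ((∑ m, (v m - (∑ l, v l) / d) ^ 2) / d + s) := by
  simp only [layerNorm, Pi.one_apply, Pi.zero_apply]
  ring

theorem variance_pos {v : Fin d → ℝ} {i j : Fin d} (h : v i ≠ v j) :
    0 < (∑ m, (v m - (∑ l, v l) / d) ^ 2) / (d : ℝ) := by
  have hd : (0 : ℝ) < d := by exact_mod_cast i.pos
  refine div_pos ?_ hd
  by_contra! h0
  have hs : ∀ m ∈ Finset.univ, 0 ≤ (v m - (∑ l, v l) / d) ^ 2 := fun m _ => sq_nonneg _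
  have h1 := (Finset.sum_eq_zero_iff_of_nonneg hs).1 (le_antisymm h0 (Finset.sum_nonneg hs))
  have h2 : ∀ m, v m = (∑ l, v l) / d := fun m =>
    sub_eq_zero.1 (pow_eq_zero_iff two_ne_zero |>.1 (h1 m (Finset.mem_univ m)))
  exact h ((h2 i).trans (h2 j).symm)

/-- For `s = 0` the denominator vanishes at constant vectors, hence the variance condition. For
tokens it follows from their known coordinates `0` and `1`. -/
theorem continuousAt_layerNorm (hs : 0 ≤ s) (γ β : Fin d → ℝ) {v : Fin d → ℝ}
    (hv : 0 < (∑ m, (v m - (∑ l, v l) / d) ^ 2) / (d : ℝ)) :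
    ContinuousAt (layerNorm s γ β) v := by
  refine continuousAt_pi.2 fun j => ?_
  unfold layerNorm
  refine (continuousAt_const.mul (ContinuousAt.div ?_ ?_ ?_)).add continuousAt_const
  · exact Continuous.continuousAt (by fun_prop)
  · exact Continuous.continuousAt (by fun_prop)
  · exact (Real.sqrt_pos.2 (by linarith)).ne'

theorem measurable_layerNorm (γ β : Fin d → ℝ) : Measurable (layerNorm s γ β) := by
  refine measurable_pi_lambda _ fun j => ?_
  unfold layerNorm
  fun_prop

/-- A vector with two known coordinates can be recovered from its normalisation. -/
theorem layerNorm_decode (hs : 0 ≤ s) {v : Fin d → ℝ} {i₀ i₁ : Fin d} (h₀ : v i₀ = 0)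
    (h₁ : v i₁ = 1) (j : Fin d) :
    (layerNorm s 1 0 v j - layerNorm s 1 0 v i₀) /
      (layerNorm s 1 0 v i₁ - layerNorm s 1 0 v i₀) = v j := by
  have hv := variance_pos (v := v) (i := i₀) (j := i₁) (by simp [h₀, h₁])
  have hr := Real.sqrt_pos.2 (add_pos_of_pos_of_nonneg hv hs)
  rw [layerNorm_sub, layerNorm_sub, h₀, h₁]
  field_simp
  simp

theorem layerNorm_apply_of_sum_eq_zero {v : Fin d → ℝ} (hv : ∑ l, v l = 0) (j : Fin d) :
    layerNorm s 1 0 v j = v j / Real.sqrt ((∑ m, v m ^ 2) / d + s) := by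
  simp [layerNorm, hv]

end LayerNorm

/-- A curve of vectors with mean zero and constant variance. -/
def balancedCurve {d : ℕ} (c : Fin 4 → Fin d) (B τ : ℝ) : Fin d → ℝ :=
  τ • (Pi.single (c 0) 1 - Pi.single (c 1) 1) +
    Real.sqrt (B ^ 2 - τ ^ 2) • (Pi.single (c 2) 1 - Pi.single (c 3) 1)

section BalancedCurve

variable {d : ℕ} {c : Fin 4 → Fin d} {B τ : ℝ}

theorem continuous_balancedCurve : Continuous (balancedCurve c B) := by
  unfold balancedCurve
  fun_prop

theorem sum_balancedCurve : ∑ l, balancedCurve c B τ l = 0 := by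
  simp [balancedCurve, Finset.sum_add_distrib, ← Finset.mul_sum, Finset.sum_sub_distrib]

theorem balancedCurve_apply_zero (hc : Function.Injective c) :
    balancedCurve c B τ (c 0) = τ := by
  simp [balancedCurve, hc.eq_iff]

/-- The second direction of the curve exists to compensate `τ ^ 2` in the variance, so that
normalisation rescales every point of the curve by the same factor. -/
theorem sum_sq_balancedCurve (hc : Function.Injective c) (hτ : |τ| ≤ B) :
    ∑ l, balancedCurve c B τ l ^ 2 = 2 * B ^ 2 := by
  have h0 : ∀ l ∉ Finset.univ.image c, balancedCurve c B τ l ^ 2 = 0 := by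
    intro l hl
    have : ∀ i, l ≠ c i := fun i h => hl (by simp [h])
    simp [balancedCurve, this]
  have hsq := Real.sq_sqrt (sub_nonneg.2 (sq_le_sq' (abs_le.1 hτ).1 (abs_le.1 hτ).2))
  rw [← Finset.sum_subset (Finset.subset_univ (Finset.univ.image c)) (fun l _ => h0 l),
    Finset.sum_image hc.injOn, Fin.sum_univ_four]
  simp [balancedCurve, hc.eq_iff]
  linarith

end BalancedCurve

/-- A feedforward sublayer between two layer normalisations, followed by a linear readout,
approximates every continuous function of vectors with two known coordinates. -/
theorem exists_ffn_layerNorm_approx {d : ℕ} {c : Fin 4 → Fin d} (hc : Function.Injective c)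
    {s : ℝ} (hs : 0 ≤ s) {V : Set (Fin d → ℝ)} (hV : IsCompact V) (h₀ : ∀ v ∈ V, v (c 0) = 0)
    (h₁ : ∀ v ∈ V, v (c 1) = 1) {f : (Fin d → ℝ) → ℝ} (hf : ContinuousOn f V)
    {ε : ℝ} (hε : 0 < ε) :
    ∃ (r : ℕ) (W₁ : Matrix (Fin d) (Fin r) ℝ) (b₁ : Fin r → ℝ) (W₂ : Matrix (Fin r) (Fin d) ℝ)
      (ρ : Fin d → ℝ), ∀ v ∈ V, |layerNorm s 1 0 (layerNorm s 1 0 v +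
        (fun l => max 0 ((layerNorm s 1 0 v ᵥ* W₁ + b₁) l)) ᵥ* W₂) ⬝ᵥ ρ - f v| < ε := by
  -- Strict positivity of `B` keeps the variance on the curve positive even if `f` vanishes and `s =
  -- 0`.
  obtain ⟨B, hB, hfB⟩ : ∃ B > 0, ∀ v ∈ V, |f v| ≤ B := by
    obtain ⟨B, hB⟩ := hV.exists_bound_of_continuousOn hf
    exact ⟨|B| + 1, by positivity, fun v hv => (hB v hv).trans (by linarith [le_abs_self B])⟩
  have hd : (0 : ℝ) < d := by exact_mod_cast (c 0).pos
  have hvar : 0 < 2 * B ^ 2 / (d : ℝ) := by positivity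
  set lam : ℝ := Real.sqrt (2 * B ^ 2 / d + s) with hlam
  have hlam0 : 0 < lam := Real.sqrt_pos.2 (by linarith)
  have hq : ∀ τ ∈ Icc (-B) B, layerNorm s 1 0 (balancedCurve c B τ) (c 0) = τ / lam := by
    intro τ hτ
    rw [layerNorm_apply_of_sum_eq_zero sum_balancedCurve, balancedCurve_apply_zero hc,
      sum_sq_balancedCurve hc (abs_le.2 hτ)]
  have hS : IsCompact (balancedCurve c B '' Icc (-B) B) :=
    isCompact_Icc.image continuous_balancedCurve
  have hSc : ∀ w ∈ balancedCurve c B '' Icc (-B) B,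
      ContinuousAt (fun w => layerNorm s 1 0 w (c 0)) w := by
    rintro _ ⟨τ, hτ, rfl⟩
    refine (continuous_apply (c 0)).continuousAt.comp (continuousAt_layerNorm hs 1 0 ?_)
    simpa [sum_balancedCurve, sum_sq_balancedCurve hc (abs_le.2 hτ)] using hvar
  -- The network output is only near the curve, not on it. Continuity at each point of the compact
  -- curve gives a `δ` valid for all nearby vectors of the ambient space.
  obtain ⟨δ, hδ, hδ'⟩ := Metric.mem_uniformity_dist.1
    (hS.uniformContinuousAt_of_continuousAt _ hSc (Metric.dist_mem_uniformity (div_pos hε hlam0)))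
  have hVc : ContinuousOn (layerNorm s 1 0) V := fun v hv =>
    (continuousAt_layerNorm hs 1 0 (variance_pos (i := c 0) (j := c 1)
      (by simp [h₀ v hv, h₁ v hv]))).continuousWithinAt
  let dec : (Fin d → ℝ) → Fin d → ℝ := fun Y j => (Y j - Y (c 0)) / (Y (c 1) - Y (c 0))
  have hdec : ∀ v ∈ V, dec (layerNorm s 1 0 v) = v := fun v hv =>
    funext (layerNorm_decode hs (h₀ v hv) (h₁ v hv))
  have hdecc : ContinuousOn dec (layerNorm s 1 0 '' V) := by
    refine continuousOn_pi.2 fun j => ContinuousOn.div (by fun_prop) (by fun_prop) ?_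
    rintro _ ⟨v, hv, rfl⟩ h
    have := congrFun (hdec v hv) (c 1)
    simp [dec, h, h₁ v hv] at this
  -- The subtracted `Y` cancels the residual connection around the feedforward network.
  have hF : ContinuousOn (fun Y => balancedCurve c B (f (dec Y)) - Y) (layerNorm s 1 0 '' V) := by
    refine (continuous_balancedCurve.comp_continuousOn (hf.comp hdecc ?_)).sub continuousOn_id
    rintro _ ⟨v, hv, rfl⟩
    rwa [hdec v hv]
  obtain ⟨r, W₁, b₁, W₂, h⟩ := exists_ffn_approx (hV.image_of_continuousOn hVc) hF (half_pos hδ)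
  -- The readout factor `lam` undoes the division by the common standard deviation.
  refine ⟨r, W₁, b₁, W₂, Pi.single (c 0) lam, fun v hv => ?_⟩
  have hτ := abs_le.1 (hfB v hv)
  have h2 : dist (balancedCurve c B (f v)) (layerNorm s 1 0 v +
      (fun l => max 0 ((layerNorm s 1 0 v ᵥ* W₁ + b₁) l)) ᵥ* W₂) < δ := by
    refine lt_of_le_of_lt ((dist_pi_le_iff (half_pos hδ).le).2 fun j => ?_) (half_lt_self hδ)
    have := (h _ ⟨v, hv, rfl⟩ j).le
    simp only [hdec v hv, Pi.sub_apply] at this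
    rw [dist_comm, Real.dist_eq]
    refine le_trans (le_of_eq ?_) this
    congr 1
    rw [Pi.add_apply]
    ring
  have h3 := hδ' h2 ⟨f v, hτ, rfl⟩
  simp only [hq _ hτ, mem_ofPred_eq, Real.dist_eq] at h3
  rw [dotProduct_single, abs_sub_comm]
  rw [lt_div_iff₀ hlam0, ← abs_of_pos hlam0, ← abs_mul, abs_of_pos hlam0, sub_mul,
    div_mul_cancel₀ _ hlam0.ne'] at h3
  exact h3

/-! ### A transformer layer whose heads collect the values of all tokens -/

section Gather

variable {n d r : ℕ} (c : Fin 4 ⊕ Fin n ⊕ Fin n → Fin d)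

/-- The layer in which the `k`-th head attends to the `k`-th token. The coordinates
`c (inl 0), …, c (inl 3)` hold the constants `0` and `1` and the two components of the token, then
come a one-hot encoding of the position and one slot for each head. -/
def gatherLayer (W₁ : Matrix (Fin d) (Fin r) ℝ) (b₁ : Fin r → ℝ)
    (W₂ : Matrix (Fin r) (Fin d) ℝ) : TransformerLayer d n 1 1 r where
  WQ := fun _ => Matrix.of fun l _ => if l = c (.inl 1) then 1 else 0
  WK := fun k => Matrix.of fun l _ => if l = c (.inr (.inl k)) then 1 else 0
  WV := fun _ => Matrix.of fun l _ => if l = c (.inl 3) then 1 else 0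
  WO := Matrix.of fun k => Pi.single (c (.inr (.inr k.1))) 1
  W₁ := W₁
  b₁ := b₁
  W₂ := W₂
  b₂ := 0
  γ₁ := 1
  β₁ := 0
  γ₂ := 1
  β₂ := 0

/-- The embedding of the two components of a token into the coordinates `2` and `3`. -/
def gatherEmbed : Matrix (Fin 2) (Fin d) ℝ :=
  Matrix.of ![Pi.single (c (.inl 2)) 1, Pi.single (c (.inl 3)) 1]

/-- The positional encodings: the constant `1` and a one-hot encoding. -/
def gatherPos : Matrix (Fin n) (Fin d) ℝ :=
  Matrix.of fun i => Pi.single (c (.inl 1)) 1 + Pi.single (c (.inr (.inl i))) 1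

/-- The transformer whose only layer is `gatherLayer`. -/
def gatherTransformer (hn : 0 < n) (W₁ : Matrix (Fin d) (Fin r) ℝ) (b₁ : Fin r → ℝ)
    (W₂ : Matrix (Fin r) (Fin d) ℝ) (ρ : Fin d → ℝ) : Transformer n 2 where
  d := d
  H := n
  dk := 1
  dv := 1
  r := r
  H_pos := hn
  dk_pos := one_pos
  dv_pos := one_pos
  embed := gatherEmbed c
  pos := gatherPos c
  layers := [gatherLayer c W₁ b₁ W₂]
  layers_ne := by simp
  readout := ρ
  readoutBias := 0

/-- The `i`-th token after the attention sublayer of `gatherTransformer`. -/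
def gathered (x η : Fin n → ℝ) (i : Fin n) : Fin d → ℝ :=
  x i • Pi.single (c (.inl 2)) 1 + η i • Pi.single (c (.inl 3)) 1 + Pi.single (c (.inl 1)) 1 +
    Pi.single (c (.inr (.inl i))) 1 +
    ∑ k, (((Real.exp 1 - 1) * η k + ∑ j, η j) / (Real.exp 1 - 1 + n)) •
      Pi.single (c (.inr (.inr k))) 1

theorem continuous_gathered (i : Fin n) :
    Continuous fun p : (Fin n → ℝ) × (Fin n → ℝ) => gathered c p.1 p.2 i := by
  unfold gathered
  fun_prop

theorem sum_exp_ite (k : Fin n) :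
    ∑ l, Real.exp (if l = k then 1 else 0) = Real.exp 1 - 1 + n := by
  have : ∀ l, Real.exp (if l = k then 1 else 0) = (if l = k then Real.exp 1 - 1 else 0) + 1 := by
    intro l
    split_ifs <;> simp
  simp [this, Finset.sum_add_distrib]

/-- All queries equal `1` and the key of head `k` is the indicator of token `k`. Each softmax row of
head `k` therefore has weight `e / (e - 1 + n)` at `k` and `1 / (e - 1 + n)` elsewhere, and every
token gets the same mixture in slot `k`. -/
theorem gatherTransformer_eval (hc : Function.Injective c) (hn : 0 < n)
    (W₁ : Matrix (Fin d) (Fin r) ℝ) (b₁ : Fin r → ℝ) (W₂ : Matrix (Fin r) (Fin d) ℝ)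
    (ρ : Fin d → ℝ) (s : ℝ) (x η : Fin n → ℝ) (i : Fin n) :
    (gatherTransformer c hn W₁ b₁ W₂ ρ).eval s (Matrix.of fun j => ![x j, η j]) i =
      layerNorm s 1 0 (layerNorm s 1 0 (gathered c x η i) +
        (fun l => max 0 ((layerNorm s 1 0 (gathered c x η i) ᵥ* W₁ + b₁) l)) ᵥ* W₂) ⬝ᵥ ρ := by
  set L := gatherLayer c W₁ b₁ W₂ with hL
  set Z : Matrix (Fin n) (Fin d) ℝ := (Matrix.of fun j => ![x j, η j]) * gatherEmbed c +
    gatherPos c with hZ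
  have hZi : ∀ i, Z i = x i • Pi.single (c (.inl 2)) 1 + η i • Pi.single (c (.inl 3)) 1 +
      Pi.single (c (.inl 1)) 1 + Pi.single (c (.inr (.inl i))) 1 := by
    intro i
    funext l
    simp [hZ, gatherEmbed, gatherPos, Matrix.add_apply, Matrix.mul_apply, Fin.sum_univ_two,
      add_assoc]
  have hQ : ∀ k i u, (Z * L.WQ k) i u = 1 := by
    intro k i u
    simp [Matrix.mul_apply, hL, gatherLayer, hZi, Pi.single_apply, hc.eq_iff]
  have hK : ∀ k i u, (Z * L.WK k) i u = if i = k then 1 else 0 := by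
    intro k i u
    simp [Matrix.mul_apply, hL, gatherLayer, hZi, Pi.single_apply, hc.eq_iff, eq_comm]
  have hVal : ∀ k i u, (Z * L.WV k) i u = η i := by
    intro k i u
    simp [Matrix.mul_apply, hL, gatherLayer, hZi, Pi.single_apply, hc.eq_iff]
  have hatt : ∀ k i u, attention (Z * L.WQ k) (Z * L.WK k) (Z * L.WV k) i u =
      ((Real.exp 1 - 1) * η k + ∑ j, η j) / (Real.exp 1 - 1 + n) := by
    intro k i u
    have hA : ∀ i j, (((Real.sqrt (1 : ℕ))⁻¹ • ((Z * L.WQ k) * (Z * L.WK k)ᵀ) :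
        Matrix (Fin n) (Fin n) ℝ)) i j = if j = k then 1 else 0 := by
      intro i j
      rw [Matrix.smul_apply, Matrix.mul_apply]
      simp only [Matrix.transpose_apply, hQ, hK]
      change (Real.sqrt (1 : ℕ))⁻¹ • ∑ _ : Fin 1, (1 * if j = k then (1 : ℝ) else 0) = _
      simp
    have hE : ∀ j, Real.exp (if j = k then 1 else 0) * η j =
        (if j = k then (Real.exp 1 - 1) * η j else 0) + η j := by
      intro j
      split_ifs
      · ring
      · simp
    change ∑ j, softmaxRows ((Real.sqrt (1 : ℕ))⁻¹ • ((Z * L.WQ k) * (Z * L.WK k)ᵀ)) i j *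
      (Z * L.WV k) j u = _
    simp only [softmaxRows, Matrix.of_apply, hA, hVal, sum_exp_ite, div_mul_eq_mul_div, hE,
      ← Finset.sum_div, Finset.sum_add_distrib, Finset.sum_ite_eq', Finset.mem_univ, if_true]
  have hM : ∀ i, Z i + L.multiHead Z i = gathered c x η i := by
    intro i
    rw [hZi, gathered]
    congr 1
    funext l
    simp only [TransformerLayer.multiHead, Matrix.mul_apply, Matrix.of_apply, hatt]
    change ∑ p : Fin n × Fin 1, _ * (Pi.single (c (.inr (.inr p.1))) 1 : Fin d → ℝ) l = _
    simp [Fintype.sum_prod_type, Finset.sum_apply]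
  have hffn : ∀ v, L.ffn v = (fun l => max 0 ((v ᵥ* W₁ + b₁) l)) ᵥ* W₂ := fun v => add_zero _
  have happly : L.apply s Z i = layerNorm s 1 0 (layerNorm s 1 0 (gathered c x η i) +
      (fun l => max 0 ((layerNorm s 1 0 (gathered c x η i) ᵥ* W₁ + b₁) l)) ᵥ* W₂) := by
    rw [← hM, ← hffn]
    rfl
  exact (add_zero _).trans (congrArg (· ⬝ᵥ ρ) happly)

end Gather

theorem Real.exp_one_sub_one_pos : 0 < Real.exp 1 - 1 := by
  have := Real.add_one_lt_exp (one_ne_zero (α := ℝ))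
  linarith

/-- A one-layer transformer approximates every continuous function of the first component of the
token and of the second components of all tokens. -/
theorem exists_transformer_approx {n : ℕ} (hn : 0 < n) {s : ℝ} (hs : 0 ≤ s) {I : Set ℝ}
    (hI : IsCompact I) {A : Set (Fin n → ℝ)} (hA : IsCompact A) {F : ℝ → (Fin n → ℝ) → ℝ}
    (hF : ContinuousOn (fun p : ℝ × (Fin n → ℝ) => F p.1 p.2) (I ×ˢ A)) {ε : ℝ} (hε : 0 < ε) :
    ∃ W : Transformer n 2,
      (∀ x : Fin n → ℝ, (∀ j, x j ∈ I) → ∀ η ∈ A, ∀ i,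
        |F (x i) η - W.eval s (Matrix.of fun j => ![x j, η j]) i| < ε) ∧
      ∀ (η : Fin n → ℝ) (i : Fin n), Measurable fun x : Fin n → ℝ => W.eval s (Matrix.of fun j => ![x j, η j]) i := by
  let e := Fintype.equivFin (Fin 4 ⊕ Fin n ⊕ Fin n)
  have hc := e.injective
  have he1 := Real.exp_one_sub_one_pos
  have hne : (Real.exp 1 - 1 + n) ≠ 0 := by positivity
  -- One network serves all positions, so the compact set is the union over `i`; the target is read
  -- off the token itself and does not need `i`.
  set V : Set (Fin (Fintype.card (Fin 4 ⊕ Fin n ⊕ Fin n)) → ℝ) :=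
    ⋃ i, (fun p : (Fin n → ℝ) × (Fin n → ℝ) => gathered e p.1 p.2 i) ''
      ((univ.pi fun _ => I) ×ˢ A)
  have hV : IsCompact V := isCompact_iUnion fun i =>
    ((isCompact_univ_pi fun _ => hI).prod hA).image (continuous_gathered e i)
  have hmem : ∀ v ∈ V, ∃ x : Fin n → ℝ, (∀ j, x j ∈ I) ∧ ∃ η ∈ A, ∃ i, gathered e x η i = v := by
    intro v hv
    obtain ⟨i, ⟨x, η⟩, ⟨hx, hη⟩, rfl⟩ := mem_iUnion.1 hv
    exact ⟨x, fun j => hx j trivial, η, hη, i, rfl⟩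
  have h0 : ∀ x η i, gathered e x η i (e (.inl 0)) = 0 := by
    intro x η i
    simp [gathered, Finset.sum_apply]
  have h1 : ∀ x η i, gathered e x η i (e (.inl 1)) = 1 := by
    intro x η i
    simp [gathered, Finset.sum_apply]
  have hx : ∀ x η i, gathered e x η i (e (.inl 2)) = x i := by
    intro x η i
    simp [gathered, Finset.sum_apply]
  have hslot : ∀ x η i k, gathered e x η i (e (.inr (.inr k))) =
      ((Real.exp 1 - 1) * η k + ∑ j, η j) / (Real.exp 1 - 1 + n) := by
    intro x η i k
    simp [gathered, Pi.single_apply, Finset.sum_apply]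
  -- The softmax mixtures have the same total as the values, so the sum of the slots recovers `∑ j,
  -- η j`; subtracting it isolates `(e - 1) * η k`.
  let dec : (Fin (Fintype.card (Fin 4 ⊕ Fin n ⊕ Fin n)) → ℝ) → Fin n → ℝ := fun v k =>
    ((Real.exp 1 - 1 + n) * v (e (.inr (.inr k))) - ∑ l, v (e (.inr (.inr l)))) / (Real.exp 1 - 1)
  have hdec : ∀ x η i, dec (gathered e x η i) = η := by
    intro x η i
    funext k
    simp only [dec, hslot]
    rw [← Finset.sum_div, Finset.sum_add_distrib, ← Finset.mul_sum]
    simp only [Finset.sum_const, Finset.card_univ, Fintype.card_fin, nsmul_eq_mul]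
    field_simp
    ring
  have hf : ContinuousOn (fun v => F (v (e (.inl 2))) (dec v)) V := by
    refine hF.comp (f := fun v => (v (e (.inl 2)), dec v)) (Continuous.continuousOn ?_) ?_
    · refine (continuous_apply _).prodMk (continuous_pi fun k => ?_)
      exact Continuous.div_const (by fun_prop) _
    · intro v hv
      obtain ⟨x, hxI, η, hη, i, rfl⟩ := hmem v hv
      refine ⟨?_, ?_⟩
      · simpa only [hx] using hxI i
      · simpa only [hdec] using hη
  obtain ⟨r, W₁, b₁, W₂, ρ, h⟩ := exists_ffn_layerNorm_approx
    (c := fun j => e (.inl j)) (hc.comp Sum.inl_injective) hs hV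
    (fun v hv => by obtain ⟨x, -, η, -, i, rfl⟩ := hmem v hv; exact h0 x η i)
    (fun v hv => by obtain ⟨x, -, η, -, i, rfl⟩ := hmem v hv; exact h1 x η i) hf hε
  refine ⟨gatherTransformer e hn W₁ b₁ W₂ ρ, fun x hxI η hη i => ?_, fun η i => ?_⟩
  · have := h _ (mem_iUnion.2 ⟨i, (x, η), ⟨fun j _ => hxI j, hη⟩, rfl⟩)
    simp only [hx, hdec] at this
    rwa [gatherTransformer_eval e hc, abs_sub_comm]
  · simp only [gatherTransformer_eval e hc]
    -- Measurability is composed layer by layer, since the second normalisation may be discontinuous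
    -- off the approximation set.
    have hg : Measurable fun x => layerNorm s 1 0 (gathered e x η i) :=
      (measurable_layerNorm 1 0).comp ((continuous_gathered e i).comp
        (continuous_id.prodMk continuous_const)).measurable
    have hffn : Measurable fun v : Fin (Fintype.card (Fin 4 ⊕ Fin n ⊕ Fin n)) → ℝ =>
        v + (fun l => max 0 ((v ᵥ* W₁ + b₁) l)) ᵥ* W₂ := by
      refine Continuous.measurable ?_
      unfold Matrix.vecMul dotProduct
      simp only [Pi.add_apply]
      fun_prop
    have hr : Measurable fun v : Fin (Fintype.card (Fin 4 ⊕ Fin n ⊕ Fin n)) → ℝ => v ⬝ᵥ ρ :=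
      (continuous_id.dotProduct continuous_const).measurable
    exact hr.comp ((measurable_layerNorm 1 0).comp (hffn.comp hg))

/-! ### Evaluation of functions in a Hölder space -/

section HolderEval

variable {a b : ℝ} {hab : a < b} {k : ℕ} {α : ℝ≥0}

theorem HolderSpace.abs_apply_le_norm (y : HolderSpace hab k α) (s : ℝ) : |y s| ≤ ‖y‖ := by
  have hnn : ∀ j ∈ Finset.range (k + 1), 0 ≤ ⨆ x : Icc a b, |derivIcc hab j y.toFun x| :=
    fun j _ => Real.iSup_nonneg fun x => abs_nonneg _
  have h0 : (⨆ x : Icc a b, |derivIcc hab 0 y.toFun x|) ≤ y.holderNorm := by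
    refine (Finset.single_le_sum hnn (Finset.mem_range.2 k.succ_pos)).trans ?_
    have := (nnHolderNorm α (derivIcc hab k y.toFun)).coe_nonneg
    unfold holderNorm
    linarith
  have h1 := (le_ciSup (y.bddAbove_deriv (Nat.zero_le k)) (projIcc a b hab.le s)).trans h0
  have h2 : derivIcc hab 0 y.toFun (projIcc a b hab.le s) = y s := by simp [derivIcc, IccExtend]
  rw [h2] at h1
  exact h1

theorem HolderSpace.continuous_apply (y : HolderSpace hab k α) : Continuous (y : ℝ → ℝ) := by
  have h : ContinuousOn (IccExtend hab.le y.toFun) (Icc a b) := y.2.1.continuousOn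
  have h' : Continuous y.toFun := by
    refine (continuousOn_iff_continuous_domRestrict.1 h).congr fun x => ?_
    simp [domRestrict]
  exact h'.Icc_extend'

/-- Evaluation is `1`-Lipschitz in `y` uniformly in the point, because the norm dominates the
supremum; with continuity in the point this gives joint continuity. -/
theorem HolderSpace.continuous_eval :
    Continuous fun p : HolderSpace hab k α × ℝ => p.1 p.2 := by
  refine continuous_prod_of_continuous_lipschitzWith _ 1 (fun y => y.continuous_apply)
    fun s => LipschitzWith.of_dist_le_mul fun y z => ?_
  rw [NNReal.coe_one, one_mul, dist_eq_norm y z, Real.dist_eq]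
  exact (y - z).abs_apply_le_norm s

end HolderEval

/-! ### Uniform partitions -/

/-- The points of the uniform partition of `[a,b]` into `n` intervals. -/
def uniformPartition (a b : ℝ) (n k : ℕ) : ℝ := a + k * ((b - a) / n)

section UniformPartition

variable {a b : ℝ} {n : ℕ}

theorem uniformPartition_zero : uniformPartition a b n 0 = a := by simp [uniformPartition]

theorem uniformPartition_self (hn : 0 < n) : uniformPartition a b n n = b := by
  have : (n : ℝ) ≠ 0 := by positivity
  simp only [uniformPartition]
  field_simp
  ring

theorem uniformPartition_succ_sub (k : ℕ) :
    uniformPartition a b n (k + 1) - uniformPartition a b n k = (b - a) / n := by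
  simp only [uniformPartition]
  push_cast
  ring

theorem strictMono_uniformPartition (hab : a < b) (hn : 0 < n) :
    StrictMono (uniformPartition a b n) := by
  refine strictMono_nat_of_lt_succ fun k => sub_pos.1 ?_
  rw [uniformPartition_succ_sub]
  have := sub_pos.2 hab
  positivity

theorem uniformPartition_mem_Icc (hab : a < b) (hn : 0 < n) {k : ℕ} (hk : k ≤ n) :
    uniformPartition a b n k ∈ Icc a b := by
  have h := (strictMono_uniformPartition hab hn).monotone
  have h0 := h (Nat.zero_le k)
  have h1 := h hk
  rw [uniformPartition_zero] at h0
  rw [uniformPartition_self hn] at h1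
  exact ⟨h0, h1⟩

theorem isDiscretization_uniformPartition (hab : a < b) (hn : 0 < n) :
    IsDiscretization a b fun i : Fin (n + 1) => uniformPartition a b n i :=
  ⟨fun _ _ h => strictMono_uniformPartition hab hn h, uniformPartition_zero,
    uniformPartition_self hn⟩

theorem Icc_uniformPartition_subset (hab : a < b) (hn : 0 < n) (i : Fin n) :
    Icc (uniformPartition a b n i) (uniformPartition a b n (i + 1)) ⊆ Icc a b :=
  Icc_subset_Icc (uniformPartition_mem_Icc hab hn i.2.le).1
    (uniformPartition_mem_Icc hab hn i.2).2

theorem abs_integral_sub_sum_le (hab : a < b) (hn : 0 < n) {g : ℝ → ℝ}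
    (hg : ContinuousOn g (Icc a b)) {q : Fin n → ℝ} {η : ℝ}
    (h : ∀ i : Fin n, ∀ s ∈ Icc (uniformPartition a b n i) (uniformPartition a b n (i + 1)),
      |g s - g (q i)| ≤ η) :
    |(∫ s in a..b, g s) - ∑ i : Fin n, g (q i) *
      (uniformPartition a b n (i + 1) - uniformPartition a b n i)| ≤ η * (b - a) := by
  have hmono := (strictMono_uniformPartition hab hn).monotone
  have hint : ∀ k < n, IntervalIntegrable g volume (uniformPartition a b n k)
      (uniformPartition a b n (k + 1)) := fun k hk => by
    refine (hg.mono ?_).intervalIntegrable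
    rw [uIcc_of_le (hmono k.le_succ)]
    exact Icc_uniformPartition_subset hab hn ⟨k, hk⟩
  have hsum := intervalIntegral.sum_integral_adjacent_intervals hint
  rw [uniformPartition_zero, uniformPartition_self hn, Finset.sum_range] at hsum
  rw [← hsum, ← Finset.sum_sub_distrib]
  have hterm : ∀ i : Fin n, |(∫ s in uniformPartition a b n i..uniformPartition a b n (i + 1), g s)
      - g (q i) * (uniformPartition a b n (i + 1) - uniformPartition a b n i)| ≤
      η * ((b - a) / n) := by
    intro i
    have hc : g (q i) * (uniformPartition a b n (i + 1) - uniformPartition a b n i) =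
        ∫ _ in uniformPartition a b n i..uniformPartition a b n (i + 1), g (q i) := by
      simp [mul_comm]
    rw [hc, ← intervalIntegral.integral_sub (hint i i.2) intervalIntegrable_const]
    refine (intervalIntegral.norm_integral_le_of_norm_le_const (E := ℝ) (C := η) fun s hs => ?_).trans
      (le_of_eq ?_)
    · rw [uIoc_of_le (hmono (Nat.le_succ i))] at hs
      exact h i s (Ioc_subset_Icc_self hs)
    · rw [uniformPartition_succ_sub, abs_of_nonneg]
      exact div_nonneg (sub_pos.2 hab).le n.cast_nonneg
  refine (Finset.abs_sum_le_sum_abs _ _).trans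
    ((Finset.sum_le_sum fun i _ => hterm i).trans (le_of_eq ?_))
  have : (n : ℝ) ≠ 0 := by positivity
  simp only [Finset.sum_const, Finset.card_univ, Fintype.card_fin, nsmul_eq_mul]
  field_simp

end UniformPartition

/-! ### The component-wise norm -/

theorem measurableSet_cells {n : ℕ} (t : Fin (n + 1) → ℝ) : MeasurableSet (cells t) :=
  MeasurableSet.univ_pi fun _ => measurableSet_Icc

theorem volume_cells {n : ℕ} (t : Fin (n + 1) → ℝ) :
    volume (cells t) = ∏ i : Fin n, ENNReal.ofReal (t i.succ - t i.castSucc) := by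
  simp only [cells, volume_pi_pi, Real.volume_Icc]

/-- The sum of the integrals is at most `η ^ p` times `n` times the volume, and the root returns
`η`; the bound is free of `p`, so one transformer serves every exponent. -/
theorem compNormLT_of_le {n : ℕ} {t : Fin (n + 1) → ℝ} {p ε η : ℝ} (hp : 1 ≤ p) (hη : 0 ≤ η)
    (hηε : η < ε) (hvol : n * volume.real (cells t) ≤ 1) {F : (Fin n → ℝ) → Fin n → ℝ}
    (hF : ∀ i, AEStronglyMeasurable (fun x => F x i) (volume.restrict (cells t)))
    (hle : ∀ x ∈ cells t, ∀ i, |F x i| ≤ η) : CompNormLT t p ε F := by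
  have hp0 : 0 < p := one_pos.trans_le hp
  have hfin : volume (cells t) < ⊤ := by
    rw [volume_cells]
    exact ENNReal.prod_lt_top fun i _ => ENNReal.ofReal_lt_top
  have hb : ∀ i, ∀ x ∈ cells t, ‖|F x i| ^ p‖ ≤ η ^ p := fun i x hx => by
    rw [Real.norm_eq_abs, abs_of_nonneg (Real.rpow_nonneg (abs_nonneg _) _)]
    exact Real.rpow_le_rpow (abs_nonneg _) (hle x hx i) hp0.le
  have hm : ∀ i, AEStronglyMeasurable (fun x => |F x i| ^ p) (volume.restrict (cells t)) :=
    fun i => (((hF i).aemeasurable.abs).pow_const p).aestronglyMeasurable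
  refine ⟨fun i => ?_, ?_⟩
  · have : IsFiniteMeasure (volume.restrict (cells t)) := ⟨by simpa using hfin⟩
    exact Integrable.of_bound (hm i) (η ^ p)
      ((ae_restrict_iff' (measurableSet_cells t)).2 (ae_of_all _ (hb i)))
  · have h1 : ∑ i, ∫ x in cells t, |F x i| ^ p ≤ η ^ p := by
      calc ∑ i, ∫ x in cells t, |F x i| ^ p
          ≤ ∑ _ : Fin n, η ^ p * volume.real (cells t) := Finset.sum_le_sum fun i _ =>
            (le_abs_self _).trans (norm_setIntegral_le_of_norm_le_const hfin (hb i))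
        _ = η ^ p * (n * volume.real (cells t)) := by simp; ring
        _ ≤ η ^ p := mul_le_of_le_one_right (Real.rpow_nonneg hη _) hvol
    have h0 : 0 ≤ ∑ i, ∫ x in cells t, |F x i| ^ p :=
      Finset.sum_nonneg fun i _ => integral_nonneg fun x => Real.rpow_nonneg (abs_nonneg _) _
    refine lt_of_le_of_lt (Real.rpow_le_rpow h0 h1 (by positivity)) ?_
    rwa [one_div, Real.rpow_rpow_inv hη hp0.ne']

/-- A mesh of at most `1 / 2` gives volume at most `2⁻ⁿ`, which absorbs the factor `n`. -/
theorem natCast_mul_volume_cells_le_one {a b : ℝ} {n : ℕ} (hh : (b - a) / n ≤ 1 / 2)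
    (hab : a < b) : n * volume.real
      (cells fun i : Fin (n + 1) => uniformPartition a b n i) ≤ 1 := by
  have h0 : 0 ≤ (b - a) / n := div_nonneg (sub_pos.2 hab).le n.cast_nonneg
  have hv : volume.real (cells fun i : Fin (n + 1) => uniformPartition a b n i) =
      ((b - a) / n) ^ n := by
    rw [measureReal_def, volume_cells]
    simp only [Fin.val_succ, Fin.val_castSucc, uniformPartition_succ_sub]
    simp [ENNReal.toReal_ofReal h0]
  rw [hv]
  have h2 : (n : ℝ) ≤ 2 ^ n := by exact_mod_cast Nat.lt_two_pow_self.le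
  calc (n : ℝ) * ((b - a) / n) ^ n ≤ 2 ^ n * (1 / 2) ^ n := by gcongr
    _ = 1 := by rw [← mul_pow]; norm_num

end

/-! ### Choice of the partition and assembly -/

theorem mainTheorem1 {a b : ℝ} (hab : a < b) (k : ℕ) (hk : 1 ≤ k)
    (α : ℝ≥0) (hα : 0 < α) (hα' : α ≤ 1)
    -- the kernel: continuous, and continuously differentiable in the first and third variables
    (G : ℝ → ℝ → ℝ → ℝ)
    (hG : ContinuousOn (fun z : ℝ × ℝ × ℝ => G z.1 z.2.1 z.2.2) (univ ×ˢ Icc a b ×ˢ Icc a b))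
    (hG₁ : ∀ x ∈ Icc a b, ∀ s ∈ Icc a b, ContDiff ℝ 1 (fun u => G u x s))
    (hG₃ : ∀ u : ℝ, ∀ x ∈ Icc a b, ContDiffOn ℝ 1 (fun s => G u x s) (Icc a b))
    -- the Urysohn integral operator
    (T : HolderSpace hab k α → HolderSpace hab k α)
    (hT : ∀ y, ∀ x ∈ Icc a b, T y x = ∫ s in a..b, G (y s) x s)
    (K : Set (HolderSpace hab k α)) (hK : IsCompact K)
    -- the stabilising constant of layer normalisation
    (σ : ℝ) (hσ : 0 ≤ σ)
    (ε : ℝ) (hε : 0 < ε) :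
    ∃ (n : ℕ) (t : Fin (n + 1) → ℝ), IsDiscretization a b t ∧
      ∀ q : Fin n → ℝ, (∀ i, q i ∈ Icc (t i.castSucc) (t i.succ)) →
        (∀ y ∈ K, ∀ x ∈ Icc a b, |T y x - quadrature G t q y x| < ε) ∧
        ∃ W : Transformer n 2, ∀ y ∈ K, ∀ p : ℝ, 1 ≤ p →
          CompNormLT t p ε (fun x i => quadrature G t q y (x i) -
            W.eval σ (Matrix.of fun j => ![x j, y (q j)]) i) ∧
          CompNormLT t p ε (fun x i => T y (x i) -
            W.eval σ (Matrix.of fun j => ![x j, y (q j)]) i) := by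
  have hba := sub_pos.2 hab
  have hΦ : ContinuousOn (fun z : HolderSpace hab k α × ℝ × ℝ => G (z.1 z.2.2) z.2.1 z.2.2)
      (K ×ˢ Icc a b ×ˢ Icc a b) := by
    refine hG.comp (f := fun z : HolderSpace hab k α × ℝ × ℝ => (z.1 z.2.2, z.2.1, z.2.2))
      (Continuous.continuousOn ?_) fun z hz => ⟨trivial, hz.2⟩
    exact (HolderSpace.continuous_eval.comp
      (continuous_fst.prodMk continuous_snd.snd)).prodMk continuous_snd
  obtain ⟨δ, hδ, hΦδ⟩ := Metric.uniformContinuousOn_iff.1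
    ((hK.prod (isCompact_Icc.prod isCompact_Icc)).uniformContinuousOn_of_continuous hΦ)
    (ε / 3 / (b - a)) (by positivity)
  -- Mesh below `δ` controls the quadrature error; mesh below `1 / 2` controls the volume of the
  -- cells.
  obtain ⟨n, hn⟩ := exists_nat_gt ((b - a) / min δ (1 / 2))
  have hmin : 0 < min δ (1 / 2) := by positivity
  have hn0' : (0 : ℝ) < n := (div_pos hba hmin).trans hn
  have hn0 : 0 < n := by exact_mod_cast hn0'
  have hh : (b - a) / n < min δ (1 / 2) := by
    rw [div_lt_iff₀ hmin] at hn
    rwa [div_lt_iff₀ hn0', mul_comm]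
  have hhδ := hh.trans_le (min_le_left _ _)
  have hvol := natCast_mul_volume_cells_le_one (hh.le.trans (min_le_right _ _)) hab
  refine ⟨n, fun i => uniformPartition a b n i, isDiscretization_uniformPartition hab hn0,
    fun q hq => ?_⟩
  set t : Fin (n + 1) → ℝ := fun i => uniformPartition a b n i with ht
  have hsub : ∀ i : Fin n, Icc (t i.castSucc) (t i.succ) ⊆ Icc a b :=
    Icc_uniformPartition_subset hab hn0
  have hqI : ∀ i, q i ∈ Icc a b := fun i => hsub i (hq i)
  have hquad : ∀ y ∈ K, ∀ x ∈ Icc a b, |T y x - quadrature G t q y x| ≤ ε / 3 := by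
    intro y hy x hx
    have hg : ContinuousOn (fun s => G (y s) x s) (Icc a b) :=
      hΦ.comp (f := fun s => (y, x, s)) (Continuous.continuousOn (by fun_prop))
        fun s hs => ⟨hy, hx, hs⟩
    have := abs_integral_sub_sum_le hab hn0 hg (q := q) (η := ε / 3 / (b - a)) fun i s hs => by
      refine (hΦδ (y, x, s) ⟨hy, hx, hsub i hs⟩ (y, x, q i) ⟨hy, hx, hqI i⟩ ?_).le
      rw [dist_prod_same_left, dist_prod_same_left]
      refine (Real.dist_le_of_mem_Icc hs (hq i)).trans_lt ?_
      rwa [uniformPartition_succ_sub]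
    rw [div_mul_cancel₀ _ hba.ne'] at this
    rw [hT y x hx]
    exact this
  -- A norm bound on `K` confines all sample vectors to one cube, so the transformer can be chosen
  -- before `y`.
  obtain ⟨R, hR⟩ := hK.isBounded.exists_norm_le
  have hF : ContinuousOn (fun p : ℝ × (Fin n → ℝ) =>
      ∑ i, G (p.2 i) p.1 (q i) * (t i.succ - t i.castSucc))
      (Icc a b ×ˢ univ.pi fun _ => Icc (-R) R) := by
    refine continuousOn_finsetSum _ fun i _ => ContinuousOn.mul ?_ continuousOn_const
    exact hG.comp (f := fun p : ℝ × (Fin n → ℝ) => (p.2 i, p.1, q i))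
      (Continuous.continuousOn (by fun_prop)) fun p hp => ⟨trivial, hp.1, hqI i⟩
  obtain ⟨W, hW, hWm⟩ := exists_transformer_approx hn0 hσ isCompact_Icc
    (isCompact_univ_pi fun _ => isCompact_Icc)
    (F := fun x η => ∑ i, G (η i) x (q i) * (t i.succ - t i.castSucc)) hF
    (show 0 < ε / 3 by positivity)
  refine ⟨fun y hy x hx => (hquad y hy x hx).trans_lt (by linarith), W, fun y hy p hp => ?_⟩
  have hyA : (fun j => y (q j)) ∈ univ.pi fun _ : Fin n => Icc (-R) R := fun j _ =>
    abs_le.1 ((y.abs_apply_le_norm (q j)).trans (hR y hy))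
  have hcells : ∀ x ∈ cells t, ∀ j, x j ∈ Icc a b := fun x hx j => hsub j (hx j trivial)
  have h1 : ∀ x ∈ cells t, ∀ i, |quadrature G t q y (x i) -
      W.eval σ (Matrix.of fun j => ![x j, y (q j)]) i| ≤ ε / 3 := fun x hx i =>
    (hW x (hcells x hx) _ hyA i).le
  have hm := fun i => (hWm (fun j => y (q j)) i).aestronglyMeasurable
    (μ := volume.restrict (cells t))
  refine ⟨compNormLT_of_le hp (by positivity) (show ε / 3 < ε by linarith) hvol
    (fun i => AEStronglyMeasurable.sub ?_ (hm i)) h1,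
    compNormLT_of_le hp (by positivity) (show ε / 3 + ε / 3 < ε by linarith) hvol
    (fun i => AEStronglyMeasurable.sub ?_ (hm i)) fun x hx i => ?_⟩
  · refine ContinuousOn.aestronglyMeasurable ?_ (measurableSet_cells t)
    exact hF.comp (f := fun x : Fin n → ℝ => (x i, fun j => y (q j)))
      (Continuous.continuousOn (by fun_prop)) fun x hx => ⟨hcells x hx i, hyA⟩
  · exact ((T y).continuous_apply.comp (continuous_apply i)).aestronglyMeasurable
  · exact (abs_sub_le _ _ _).trans (add_le_add (hquad y hy _ (hcells x hx i)) (h1 x hx i))
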